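/- Let $\mathbf{C}$ be the Cantor space of all infinite binary sequences with the product topology; for $A\in\mathbf{C}$ let $A\upharpoonright n$ be the string of its first $n$ bits. For real $s\ge 0$, an $s$-gale is a function $d:\{0,1\}^*\to[0,\infty)$ such that $2^s d(w)=d(w0)+d(w1)$ for every $w\in\{0,1\}^*$; it is constructive if it is lower semicomputable, i.e. it is the pointwise limit of a nondecreasing sequence of rational-valued functions $\hat d(\cdot,t)$, $t\in\mathbb{N}$, with $(w,t)\mapsto\hat d(w,t)$ computable. The constructive dimension $\dim(A)$ (respectively, the constructive strong dimension $\mathrm{Dim}(A)$) of $A\in\mathbf{C}$ is the infimum of all $s\ge 0$ for which there is a constructive $s$-gale $d$ with $\limsup_{n\to\infty} d(A\upharpoonright n)=\infty$ (respectively, with $\liminf_{n\to\infty} d(A\upharpoonright n)=\infty$). Put $$\mathrm{DIM}^0=\{A\in\mathbf{C}\mid \dim(A)=0\},\qquad \mathrm{DIM}_{\mathrm{str}}^1=\{A\in\mathbf{C}\mid \mathrm{Dim}(A)=1\}.$$ Theorem. Neither $\mathrm{DIM}^0$ nor $\mathrm{DIM}_{\mathrm{str}}^1$ is a $\boldsymbol{\Sigma}^0_2$-class,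 i.e. neither is a countable union of closed subsets of $\mathbf{C}$. -/

import Mathlib

open Filter Topology
open scoped NNReal ENNReal

/-- Cantor space: infinite binary sequences, with the product topology. -/
abbrev CantorSpace : Type := ℕ → Bool

/-- The string of the first `n` bits of `A`. -/
def CantorSpace.take (A : CantorSpace) (n : ℕ) : List Bool := List.ofFn fun i : Fin n => A i

/-- An `s`-gale: `2 ^ s * d(w) = d(w0) + d(w1)` for all strings `w`. -/
def IsGale (s : ℝ≥0) (d : List Bool → ℝ≥0) : Prop :=
  ∀ w : List Bool, (2 : ℝ≥0) ^ (s : ℝ) * d w = d (w ++ [false]) + d (w ++ [true])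

/-- `d` is lower semicomputable: it is the pointwise limit of a nondecreasing sequence of
nonnegative rationals `p w t / (q w t + 1)` computed uniformly from `w` and `t`. -/
def IsLowerSemicomputable (d : List Bool → ℝ≥0) : Prop :=
  ∃ p q : List Bool → ℕ → ℕ, Computable₂ p ∧ Computable₂ q ∧
    ∀ w : List Bool, Monotone (fun t => (p w t : ℝ≥0) / ((q w t : ℝ≥0) + 1)) ∧
      Tendsto (fun t => (p w t : ℝ≥0) / ((q w t : ℝ≥0) + 1)) atTop (𝓝 (d w))

/-- A constructive `s`-gale. -/
def IsConstructiveGale (s : ℝ≥0) (d : List Bool → ℝ≥0) : Prop :=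
  IsGale s d ∧ IsLowerSemicomputable d

/-- The success set of `d`. -/
def successSet (d : List Bool → ℝ≥0) : Set CantorSpace :=
  {A | limsup (fun n => (d (A.take n) : ℝ≥0∞)) atTop = ∞}

/-- The strong success set of `d`. -/
def strongSuccessSet (d : List Bool → ℝ≥0) : Set CantorSpace :=
  {A | liminf (fun n => (d (A.take n) : ℝ≥0∞)) atTop = ∞}

/-- Constructive dimension of a class of sequences: the infimum of all `s ∈ [0, ∞)` for which
some constructive `s`-gale succeeds on the class. -/
noncomputable def cdim (X : Set CantorSpace) : ℝ≥0∞ :=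
  sInf {a | ∃ s : ℝ≥0, a = s ∧ ∃ d, IsConstructiveGale s d ∧ X ⊆ successSet d}

/-- Constructive strong dimension of a class of sequences. -/
noncomputable def cDimStr (X : Set CantorSpace) : ℝ≥0∞ :=
  sInf {a | ∃ s : ℝ≥0, a = s ∧ ∃ d, IsConstructiveGale s d ∧ X ⊆ strongSuccessSet d}

/-- The class of all sequences of constructive dimension `α`. -/
def DIM (α : ℝ≥0∞) : Set CantorSpace := {A | cdim {A} = α}

/-- The class of all sequences of constructive strong dimension `α`. -/
def DIMstr (α : ℝ≥0∞) : Set CantorSpace := {A | cDimStr {A} = α}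

/-- The boldface classes `Σ⁰ₙ` (`n ≥ 1`) of the Borel hierarchy on Cantor space: `Σ⁰₁` consists
of the open sets, and `Σ⁰ₙ₊₁` of the countable unions of sets whose complements are `Σ⁰ₙ`
(that is, of `Π⁰ₙ` sets). The index `0` is not used. -/
def BoldSigma : ℕ → Set (Set CantorSpace)
  | 0 => ∅
  | 1 => {X | IsOpen X}
  | n + 2 => {X | ∃ F : ℕ → Set CantorSpace, (∀ i, (F i)ᶜ ∈ BoldSigma (n + 1)) ∧ X = ⋃ i, F i}

/-!
Both classes are comeager with dense complement, and by the Baire category theorem such a set is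
not a countable union of closed sets (`not_mem_boldSigma_two`): one of the closed sets would have
nonempty interior.

Upper bounds on dimensions come from explicit gales which multiply the capital by `a b / c` when
the bit `b` is read (`prodGale`); they are constructive `s`-gales when `2 ^ s = (a 0 + a 1) / c`.
For `2 ^ s` slightly larger than `1` one of them wins on every `0` and never loses everything, so
along a generic sequence, which contains extremely long runs of zeros, it is unbounded. Hence
generic sequences have dimension `0`. For the same reason, a sequence that is eventually `0` has
strong dimension less than `1`, and such sequences are dense.

Lower bounds use that there are only countably many lower semicomputable functions
(`countable_setOf_isLowerSemicomputable`). If `s ≤ 1`, an `s`-gale is a supermartingale, and so is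
a weighted sum of all of them; starting from any string and always choosing the bit which does not
increase this sum, one gets a sequence on which no gale succeeds
(`exists_bounded_mem_cylinder`). So sequences of positive dimension are dense. If `s < 1`, any
string has an extension on which a given `s`-gale is less than `1`, so along a generic sequence
every such gale is infinitely often less than `1`, and the strong dimension is at least `1`.
-/

/-! ### Cylinders and Baire category -/

theorem CantorSpace.take_succ (A : CantorSpace) (n : ℕ) : A.take (n + 1) = A.take n ++ [A n] := by
  rw [CantorSpace.take, List.ofFn_succ_last]
  rfl

theorem CantorSpace.take_eq_of_mem_cylinder {A B : CantorSpace} {n : ℕ}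
    (h : B ∈ PiNat.cylinder A n) : B.take n = A.take n := by
  rw [PiNat.mem_cylinder_iff] at h
  simp only [CantorSpace.take]
  congr 1
  funext i
  exact h i i.2

/-- A rule which chooses the next bit from the bits chosen so far can be followed from any initial
string on. -/
theorem exists_mem_cylinder_forall_eq (f : List Bool → Bool) (A : CantorSpace) (n : ℕ) :
    ∃ B ∈ PiNat.cylinder A n, ∀ m, n ≤ m → B m = f (CantorSpace.take B m) := by
  let g : ℕ → List Bool → Bool := fun m w => if m < n then A m else f w
  let L : ℕ → List Bool := fun m => Nat.rec [] (fun m w => w ++ [g m w]) m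
  let B : CantorSpace := fun m => g m (L m)
  have hL : ∀ m, B.take m = L m := by
    intro m
    induction m with
    | zero => simp [CantorSpace.take, L]
    | succ m ih => rw [CantorSpace.take_succ, ih]
  refine ⟨B, ?_, fun m hm => ?_⟩
  · rw [PiNat.mem_cylinder_iff]
    intro i hi
    simp [B, g, hi]
  · rw [hL]
    simp [B, g, not_lt.2 hm]

theorem exists_cylinder_subset {U : Set CantorSpace} (hU : IsOpen U) {A : CantorSpace}
    (hA : A ∈ U) : ∃ n, PiNat.cylinder A n ⊆ U := by
  obtain ⟨_, ⟨B, n, rfl⟩, hAB, hBU⟩ :=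
    (PiNat.isTopologicalBasis_cylinders (fun _ : ℕ => Bool)).exists_subset_of_mem_open hA hU
  exact ⟨n, by rwa [← PiNat.mem_cylinder_iff_eq.1 hAB] at hBU⟩

theorem dense_of_inter_cylinder {X : Set CantorSpace}
    (h : ∀ A n, ∃ B ∈ PiNat.cylinder A n, B ∈ X) : Dense X := by
  rw [dense_iff_inter_open]
  rintro U hU ⟨A, hA⟩
  obtain ⟨n, hn⟩ := exists_cylinder_subset hU hA
  obtain ⟨B, hB, hX⟩ := h A n
  exact ⟨B, hn hB, hX⟩

theorem not_mem_boldSigma_two {X G : Set CantorSpace} (hG : IsGδ G) (hd : Dense G) (hGX : G ⊆ X)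
    (hX : Dense Xᶜ) : X ∉ BoldSigma 2 := by
  rintro ⟨F, hF, rfl⟩
  have hc : ∀ i, IsClosed (F i) := fun i => isOpen_compl_iff.1 (hF i)
  have hi := hG.dense_iUnion_interior_of_closed hd hc hGX
  obtain ⟨A, hA⟩ := hi.nonempty
  obtain ⟨B, hB, hB'⟩ := hX.inter_open_nonempty _
    (isOpen_iUnion fun i => isOpen_interior (s := F i)) ⟨A, hA⟩
  exact hB' (Set.iUnion_mono (fun i => interior_subset) hB)

theorem isOpen_setOf_take (P : List Bool → Prop) (n : ℕ) :
    IsOpen {A : CantorSpace | P (A.take n)} := by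
  rw [isOpen_iff_mem_nhds]
  intro A hA
  refine mem_of_superset ((PiNat.isOpen_cylinder _ A n).mem_nhds (PiNat.self_mem_cylinder A n)) ?_
  intro B hB
  simpa [CantorSpace.take_eq_of_mem_cylinder hB] using hA

theorem setOf_frequently_take_eq (P : List Bool → Prop) :
    {A : CantorSpace | ∃ᶠ n in atTop, P (A.take n)} =
      ⋂ N : ℕ, ⋃ n : ℕ, ⋃ _ : N ≤ n, {A | P (A.take n)} := by
  ext A
  simp [frequently_atTop]

theorem isOpen_iUnion_setOf_take (P : List Bool → Prop) (N : ℕ) :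
    IsOpen (⋃ n : ℕ, ⋃ _ : N ≤ n, {A : CantorSpace | P (A.take n)}) :=
  isOpen_iUnion fun n => isOpen_iUnion fun _ => isOpen_setOf_take P n

theorem isGδ_setOf_frequently_take (P : List Bool → Prop) :
    IsGδ {A : CantorSpace | ∃ᶠ n in atTop, P (A.take n)} := by
  rw [setOf_frequently_take_eq]
  exact IsGδ.iInter_of_isOpen (isOpen_iUnion_setOf_take P)

theorem dense_setOf_frequently_take {P : List Bool → Prop}
    (h : ∀ (A : CantorSpace) (n : ℕ), ∃ B ∈ PiNat.cylinder A n, ∃ m ≥ n, P (CantorSpace.take B m)) :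
    Dense {A : CantorSpace | ∃ᶠ n in atTop, P (A.take n)} := by
  rw [setOf_frequently_take_eq]
  refine dense_iInter_of_isOpen_nat (isOpen_iUnion_setOf_take P) fun N => ?_
  refine dense_of_inter_cylinder fun A n => ?_
  obtain ⟨B, hB, m, hm, hP⟩ := h A (max n N)
  refine ⟨B, PiNat.cylinder_anti A (le_max_left n N) hB, ?_⟩
  simp only [Set.mem_iUnion]
  exact ⟨m, (le_max_right n N).trans hm, hP⟩

/-! ### Countability of lower semicomputability -/

theorem countable_setOf_computable {α β : Type*} [Primcodable α] [Primcodable β] :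
    {f : α → β | Computable f}.Countable := by
  have h : ∀ f : {f : α → β | Computable f}, ∃ c : Nat.Partrec.Code,
      c.eval = fun n => Part.bind (Encodable.decode (α := α) n)
        fun a => (Part.some (f.1 a)).map Encodable.encode :=
    fun f => Nat.Partrec.Code.exists_code.1 f.2
  choose c hc using h
  have hinj : Function.Injective c := by
    intro f g hfg
    apply Subtype.ext
    funext a
    have := congrFun ((hc f).symm.trans ((congrArg _ hfg).trans (hc g))) (Encodable.encode a)
    simpa using this
  exact hinj.countable

theorem countable_setOf_isLowerSemicomputable :
    {d : List Bool → ℝ≥0 | IsLowerSemicomputable d}.Countable := by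
  let S := {f : List Bool × ℕ → ℕ | Computable f}
  have hS : S.Countable := countable_setOf_computable
  have : Countable S := hS
  have h : ∀ d : {d : List Bool → ℝ≥0 | IsLowerSemicomputable d}, ∃ p : S × S, ∀ w,
      Tendsto (fun t => (p.1.1 (w, t) : ℝ≥0) / ((p.2.1 (w, t) : ℝ≥0) + 1)) atTop
        (𝓝 (d.1 w)) := by
    rintro ⟨d, p, q, hp, hq, h⟩
    exact ⟨(⟨_, hp⟩, ⟨_, hq⟩), fun w => (h w).2⟩
  choose c hc using h
  have hinj : Function.Injective c := by
    intro d e hde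
    apply Subtype.ext
    funext w
    have h1 := hc d w
    rw [hde] at h1
    exact tendsto_nhds_unique h1 (hc e w)
  exact hinj.countable

/-! ### Gales of exponent at most one -/

theorem IsGale.add_le {s : ℝ≥0} {d : List Bool → ℝ≥0} (h : IsGale s d) (hs : s ≤ 1)
    (w : List Bool) : d (w ++ [false]) + d (w ++ [true]) ≤ 2 * d w := by
  rw [← h w]
  gcongr
  calc (2 : ℝ≥0) ^ (s : ℝ) ≤ 2 ^ (1 : ℝ) :=
        NNReal.rpow_le_rpow_of_exponent_le one_le_two (by exact_mod_cast hs)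
    _ = 2 := NNReal.rpow_one 2

/-- In every cylinder there is a sequence along which all constructive gales of exponent at most
one stay bounded. -/
theorem exists_bounded_mem_cylinder (A : CantorSpace) (n : ℕ) :
    ∃ B ∈ PiNat.cylinder A n, ∀ (s : ℝ≥0) (d : List Bool → ℝ≥0), s ≤ 1 →
      IsConstructiveGale s d → B ∉ successSet d := by
  let T := {d : List Bool → ℝ≥0 | IsLowerSemicomputable d ∧ ∃ s ≤ 1, IsGale s d}
  have hT : T.Countable := countable_setOf_isLowerSemicomputable.mono fun d hd => hd.1
  have : Countable T := hT
  -- The weights make the sum `D` of all gales finite at the initial string only; the choice of bits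
  -- keeps it finite from there on. Values in `ℝ≥0∞` avoid questions of summability elsewhere.
  obtain ⟨δ, hδ, hsum⟩ := ENNReal.exists_pos_tsum_mul_lt_of_countable (ε := 1) one_ne_zero
    (fun d : T => ((d.1 (A.take n) : ℝ≥0) : ℝ≥0∞)) (fun d => ENNReal.coe_ne_top)
  let D : List Bool → ℝ≥0∞ := fun w => ∑' d : T, (d.1 w : ℝ≥0∞) * δ d
  have hD : ∀ w, D (w ++ [false]) + D (w ++ [true]) ≤ 2 * D w := by
    intro w
    simp only [D]
    rw [← ENNReal.tsum_add, ← ENNReal.tsum_mul_left]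
    refine ENNReal.tsum_le_tsum fun d => ?_
    obtain ⟨s, hs, hg⟩ := d.2.2
    rw [← add_mul, ← mul_assoc]
    gcongr
    exact_mod_cast hg.add_le hs w
  have hstep : ∀ w, ∃ b, D (w ++ [b]) ≤ D w := by
    intro w
    by_contra! h
    have := ENNReal.add_lt_add (h false) (h true)
    rw [← two_mul] at this
    exact absurd (hD w) (not_le.2 this)
  choose f hf using hstep
  obtain ⟨B, hB, hBf⟩ := exists_mem_cylinder_forall_eq f A n
  refine ⟨B, hB, fun s d hs hd hBd => ?_⟩
  have hle : ∀ m, n ≤ m → D (CantorSpace.take B m) ≤ 1 := by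
    intro m hm
    induction m, hm using Nat.le_induction with
    | base => rw [CantorSpace.take_eq_of_mem_cylinder hB]; exact hsum.le
    | succ m hm ih => rw [CantorSpace.take_succ, hBf m hm]; exact (hf _).trans ih
  let e : T := ⟨d, hd.2, s, hs, hd.1⟩
  have hδe : (δ e : ℝ≥0∞) ≠ 0 := by exact_mod_cast (hδ e).ne'
  have hb : ∀ m, n ≤ m → (d (CantorSpace.take B m) : ℝ≥0∞) ≤ 1 / δ e := by
    intro m hm
    rw [ENNReal.le_div_iff_mul_le (Or.inl hδe) (Or.inl ENNReal.coe_ne_top)]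
    exact (ENNReal.le_tsum (f := fun d : T => (d.1 (CantorSpace.take B m) : ℝ≥0∞) * δ d) e).trans
      (hle m hm)
  have hlim : limsup (fun m => (d (CantorSpace.take B m) : ℝ≥0∞)) atTop ≤ 1 / δ e :=
    limsup_le_of_le (h := eventually_atTop.2 ⟨n, hb⟩)
  rw [show limsup (fun m => (d (CantorSpace.take B m) : ℝ≥0∞)) atTop = ∞ from hBd] at hlim
  exact ENNReal.div_ne_top ENNReal.one_ne_top hδe (top_le_iff.1 hlim)

/-- A gale of exponent less than one can be made small by extending any given string. -/
theorem IsGale.exists_lt_one {s : ℝ≥0} {d : List Bool → ℝ≥0} (h : IsGale s d) (hs : s < 1)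
    (A : CantorSpace) (n : ℕ) :
    ∃ B ∈ PiNat.cylinder A n, ∃ m ≥ n, d (CantorSpace.take B m) < 1 := by
  set r : ℝ≥0 := 2 ^ (s : ℝ) / 2 with hr
  have hr1 : r < 1 := by
    rw [hr, div_lt_one two_pos]
    calc (2 : ℝ≥0) ^ (s : ℝ) < 2 ^ (1 : ℝ) :=
          NNReal.rpow_lt_rpow_of_exponent_lt one_lt_two (by exact_mod_cast hs)
      _ = 2 := NNReal.rpow_one 2
  have hstep : ∀ w, ∃ b, d (w ++ [b]) ≤ r * d w := by
    intro w
    by_contra! hw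
    have h1 := add_lt_add (hw false) (hw true)
    rw [← h w, ← two_mul, ← mul_assoc, hr, mul_div_cancel₀ _ two_ne_zero] at h1
    exact lt_irrefl _ h1
  choose f hf using hstep
  obtain ⟨B, hB, hBf⟩ := exists_mem_cylinder_forall_eq f A n
  have hle : ∀ k, d (CantorSpace.take B (n + k)) ≤ r ^ k * d (CantorSpace.take B n) := by
    intro k
    induction k with
    | zero => simp
    | succ k ih =>
      rw [← add_assoc, CantorSpace.take_succ, hBf (n + k) (Nat.le_add_right n k), pow_succ',
        mul_assoc]
      exact (hf _).trans (by gcongr)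
  have hlim : Tendsto (fun k => r ^ k * d (CantorSpace.take B n)) atTop (𝓝 0) := by
    simpa using (tendsto_pow_atTop_nhds_zero_of_lt_one (zero_le (a := r)) hr1).mul_const
      (d (CantorSpace.take B n))
  obtain ⟨k, hk⟩ := (hlim.eventually_lt_const one_pos).exists
  exact ⟨B, hB, n + k, Nat.le_add_right n k, (hle k).trans_lt hk⟩

/-! ### Product gales -/

/-- The gale which multiplies the capital by `a b / c` when the bit `b` is read. -/
noncomputable def prodGale (a : Bool → ℕ) (c : ℕ) (w : List Bool) : ℝ≥0 :=
  (w.map fun b => (a b : ℝ≥0) / c).prod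

theorem prodGale_append (a : Bool → ℕ) (c : ℕ) (w : List Bool) (b : Bool) :
    prodGale a c (w ++ [b]) = prodGale a c w * (a b / c) := by
  simp [prodGale]

theorem prodGale_pos {a : Bool → ℕ} {c : ℕ} (ha : ∀ b, 0 < a b) (hc : 0 < c) (w : List Bool) :
    0 < prodGale a c w := by
  induction w using List.reverseRecOn with
  | nil => simp [prodGale]
  | append_singleton w b ih =>
    rw [prodGale_append]
    have := ha b
    positivity

theorem computable_map_prod (a : Bool → ℕ) :
    Computable fun w : List Bool => (w.map a).prod := by
  have h : Primrec fun w : List Bool => (w.map a).foldr (· * ·) 1 :=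
    Primrec.list_foldr
      (Primrec.list_map Primrec.id ((Primrec.dom_finite a).comp Primrec.snd).to₂)
      (Primrec.const 1)
      ((Primrec.nat_mul.comp (Primrec.fst.comp Primrec.snd) (Primrec.snd.comp Primrec.snd)).to₂)
  exact h.to_comp

theorem prodGale_eq_div (a : Bool → ℕ) (c : ℕ) (w : List Bool) :
    prodGale a c w = ((w.map a).prod : ℕ) / ((w.map fun _ => c).prod : ℕ) := by
  induction w with
  | nil => simp [prodGale]
  | cons b w ih =>
    simp only [prodGale, List.map_cons, List.prod_cons, Nat.cast_mul] at ih ⊢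
    rw [ih, mul_div_mul_comm]

theorem isLowerSemicomputable_prodGale (a : Bool → ℕ) {c : ℕ} (hc : 0 < c) :
    IsLowerSemicomputable (prodGale a c) := by
  have hden : Computable fun w : List Bool => (w.map fun _ => c).prod - 1 :=
    (Primrec.pred.to_comp).comp (computable_map_prod fun _ => c)
  have key : ∀ w : List Bool, (((w.map a).prod : ℕ) : ℝ≥0) /
      ((((w.map fun _ => c).prod - 1 : ℕ) : ℝ≥0) + 1) = prodGale a c w := by
    intro w
    have hpos : 1 ≤ (w.map fun _ => c).prod := by simpa using Nat.one_le_pow _ _ hc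
    rw [prodGale_eq_div, ← Nat.cast_add_one, Nat.sub_add_cancel hpos]
  -- The denominator is shifted because approximations have the form `p / (q + 1)`.
  refine ⟨fun w _ => (w.map a).prod, fun w _ => (w.map fun _ => c).prod - 1,
    (computable_map_prod a).comp Computable.fst, hden.comp Computable.fst, fun w => ?_⟩
  simp only [key]
  exact ⟨monotone_const, tendsto_const_nhds⟩

theorem isConstructiveGale_prodGale {a : Bool → ℕ} {c : ℕ} (hc : 0 < c) {s : ℝ≥0}
    (hs : (2 : ℝ≥0) ^ (s : ℝ) = (a false + a true) / c) :
    IsConstructiveGale s (prodGale a c) := by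
  refine ⟨fun w => ?_, isLowerSemicomputable_prodGale a hc⟩
  rw [prodGale_append, prodGale_append, hs]
  ring

/-- Along a sequence whose bits eventually all increase the capital, a product gale tends to
infinity. -/
theorem tendsto_prodGale_take {a : Bool → ℕ} {c : ℕ} (ha : ∀ b, 0 < a b) (hc : 0 < c)
    {B : CantorSpace} {n : ℕ} (hB : ∀ m, n ≤ m → c < a (B m)) :
    Tendsto (fun m => prodGale a c (B.take m)) atTop atTop := by
  rw [← tendsto_add_atTop_iff_nat n]
  -- The factors are integers over `c`, so those greater than one are at least `(c + 1) / c`.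
  have h : ∀ k, prodGale a c (B.take n) * (((c : ℝ≥0) + 1) / c) ^ k ≤
      prodGale a c (B.take (k + n)) := by
    intro k
    induction k with
    | zero => simp
    | succ k ih =>
      rw [Nat.add_right_comm, CantorSpace.take_succ, prodGale_append, pow_succ, ← mul_assoc]
      gcongr
      exact_mod_cast hB _ (Nat.le_add_left n k)
  have hr : 1 < ((c : ℝ≥0) + 1) / c := by
    rw [one_lt_div (by exact_mod_cast hc)]
    exact lt_add_one _
  exact tendsto_atTop_mono h
    ((tendsto_pow_atTop_atTop_of_one_lt hr).const_mul_atTop (prodGale_pos ha hc _))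

theorem mem_strongSuccessSet_of_tendsto {d : List Bool → ℝ≥0} {A : CantorSpace}
    (h : Tendsto (fun m => d (A.take m)) atTop atTop) : A ∈ strongSuccessSet d :=
  (ENNReal.tendsto_coe_nhds_top.2 h).liminf_eq

/-! ### Exponents with a rational power of two -/

/-- The exponent `s` with `2 ^ s = (k + 2) / (k + 1)`. -/
noncomputable def smallExponent (k : ℕ) : ℝ≥0 :=
  (Real.logb 2 ((k + 2) / (k + 1))).toNNReal

theorem coe_smallExponent (k : ℕ) :
    (smallExponent k : ℝ) = Real.logb 2 ((k + 2) / (k + 1)) := by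
  refine Real.coe_toNNReal _ (Real.logb_nonneg one_lt_two ?_)
  rw [one_le_div (by positivity)]
  linarith

theorem two_rpow_smallExponent (k : ℕ) :
    (2 : ℝ≥0) ^ (smallExponent k : ℝ) = (k + 2) / (k + 1) := by
  rw [← NNReal.coe_inj, NNReal.coe_rpow, coe_smallExponent]
  push_cast
  exact Real.rpow_logb two_pos (by norm_num) (by positivity)

theorem exists_smallExponent_lt {t : ℝ≥0} (ht : 0 < t) : ∃ k, smallExponent k < t := by
  have h2 : (1 : ℝ) < 2 ^ (t : ℝ) := Real.one_lt_rpow one_lt_two (by exact_mod_cast ht)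
  obtain ⟨k, hk⟩ := exists_nat_one_div_lt (sub_pos.2 h2)
  refine ⟨k, ?_⟩
  rw [← NNReal.coe_lt_coe, coe_smallExponent, Real.logb_lt_iff_lt_rpow one_lt_two (by positivity)]
  have : ((k : ℝ) + 2) / (k + 1) = 1 + 1 / (k + 1) := by field_simp; ring
  linarith

/-- The factors of a product gale with denominator `(k + 1) * (k + 3)` which wins on zeros. -/
def zeroBet (k : ℕ) (b : Bool) : ℕ := if b then k + 2 else (k + 2) ^ 2

theorem zeroBet_pos (k : ℕ) (b : Bool) : 0 < zeroBet k b := by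
  cases b <;> simp [zeroBet]

theorem lt_zeroBet_false (k : ℕ) : (k + 1) * (k + 3) < zeroBet k false := by
  simp only [zeroBet, Bool.false_eq_true, if_false]
  nlinarith

theorem isConstructiveGale_zeroBet (k : ℕ) :
    IsConstructiveGale (smallExponent k) (prodGale (zeroBet k) ((k + 1) * (k + 3))) := by
  refine isConstructiveGale_prodGale (by positivity) ?_
  rw [two_rpow_smallExponent]
  simp only [zeroBet, Bool.false_eq_true, if_false, if_true]
  push_cast
  field_simp
  ring

/-! ### Dimension zero -/

theorem cdim_le {X : Set CantorSpace} {s : ℝ≥0} {d : List Bool → ℝ≥0}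
    (hd : IsConstructiveGale s d) (hX : X ⊆ successSet d) : cdim X ≤ s :=
  sInf_le ⟨s, rfl, d, hd, hX⟩

theorem cDimStr_le {X : Set CantorSpace} {s : ℝ≥0} {d : List Bool → ℝ≥0}
    (hd : IsConstructiveGale s d) (hX : X ⊆ strongSuccessSet d) : cDimStr X ≤ s :=
  sInf_le ⟨s, rfl, d, hd, hX⟩

theorem dense_compl_DIM_zero : Dense (DIM 0)ᶜ := by
  refine dense_of_inter_cylinder fun A n => ?_
  obtain ⟨B, hB, h⟩ := exists_bounded_mem_cylinder A n
  refine ⟨B, hB, fun h0 => ?_⟩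
  have h1 : 1 ≤ cdim {B} := by
    refine le_sInf ?_
    rintro _ ⟨s, rfl, d, hd, hs⟩
    by_contra! hs1
    exact h s d (by exact_mod_cast hs1.le) hd (hs rfl)
  rw [show cdim {B} = 0 from h0] at h1
  exact absurd h1 (by simp)

/-- The sequences along which every zero-betting gale takes arbitrarily large values arbitrarily
late. -/
def zeroGeneric : Set CantorSpace :=
  ⋂ p : ℕ × ℕ, {A | ∃ᶠ n in atTop,
    (p.2 : ℝ≥0) ≤ prodGale (zeroBet p.1) ((p.1 + 1) * (p.1 + 3)) (A.take n)}

theorem isGδ_zeroGeneric : IsGδ zeroGeneric :=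
  IsGδ.iInter fun p => isGδ_setOf_frequently_take fun w =>
    (p.2 : ℝ≥0) ≤ prodGale (zeroBet p.1) ((p.1 + 1) * (p.1 + 3)) w

theorem dense_zeroGeneric : Dense zeroGeneric := by
  refine dense_iInter_of_Gδ (fun p => isGδ_setOf_frequently_take fun w =>
    (p.2 : ℝ≥0) ≤ prodGale (zeroBet p.1) ((p.1 + 1) * (p.1 + 3)) w) fun p => ?_
  refine dense_setOf_frequently_take (P := fun w =>
    (p.2 : ℝ≥0) ≤ prodGale (zeroBet p.1) ((p.1 + 1) * (p.1 + 3)) w) fun A n => ?_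
  obtain ⟨B, hB, h0⟩ := exists_mem_cylinder_forall_eq (fun _ => false) A n
  have ht := tendsto_prodGale_take (zeroBet_pos p.1) (by positivity)
    fun m hm => (h0 m hm).symm ▸ lt_zeroBet_false p.1
  obtain ⟨m, h1, h2⟩ := ((ht.eventually_ge_atTop (p.2 : ℝ≥0)).and (eventually_ge_atTop n)).exists
  exact ⟨B, hB, m, h2, h1⟩

theorem zeroGeneric_subset_DIM_zero : zeroGeneric ⊆ DIM 0 := by
  intro A hA
  have hk : ∀ k, cdim {A} ≤ smallExponent k := by
    intro k
    refine cdim_le (isConstructiveGale_zeroBet k) (Set.singleton_subset_iff.2 ?_)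
    refine ENNReal.eq_top_of_forall_nnreal_le fun r => ?_
    obtain ⟨M, hM⟩ := exists_nat_ge r
    refine le_limsup_of_frequently_le ?_
    refine (Set.mem_iInter.1 hA (k, M)).mono fun n hn => ?_
    exact_mod_cast hM.trans hn
  show cdim {A} = 0
  refine nonpos_iff_eq_zero.1 (ENNReal.le_of_forall_pos_le_add fun t ht _ => ?_)
  obtain ⟨k, hkt⟩ := exists_smallExponent_lt ht
  rw [zero_add]
  exact (hk k).trans (by exact_mod_cast hkt.le)

/-! ### Strong dimension one -/

theorem dense_compl_DIMstr_one : Dense (DIMstr 1)ᶜ := by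
  refine dense_of_inter_cylinder fun A n => ?_
  obtain ⟨B, hB, h0⟩ := exists_mem_cylinder_forall_eq (fun _ => false) A n
  refine ⟨B, hB, fun h1 => ?_⟩
  obtain ⟨k, hk⟩ := exists_smallExponent_lt one_pos
  have hle : cDimStr {B} ≤ smallExponent k :=
    cDimStr_le (isConstructiveGale_zeroBet k) (Set.singleton_subset_iff.2
      (mem_strongSuccessSet_of_tendsto
        (tendsto_prodGale_take (zeroBet_pos k) (by positivity)
          fun m hm => (h0 m hm).symm ▸ lt_zeroBet_false k)))
  rw [show cDimStr {B} = 1 from h1] at hle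
  exact absurd hk (not_lt.2 (by exact_mod_cast hle))

/-- The constant gales with factor `(k + 2) / (k + 1)` on every bit succeed strongly everywhere. -/
theorem cDimStr_le_one (X : Set CantorSpace) : cDimStr X ≤ 1 := by
  refine ENNReal.le_of_forall_pos_le_add fun t ht _ => ?_
  obtain ⟨k, hkt⟩ := exists_smallExponent_lt ht
  have hg : IsConstructiveGale (1 + smallExponent k) (prodGale (fun _ => k + 2) (k + 1)) := by
    refine isConstructiveGale_prodGale k.succ_pos ?_
    rw [NNReal.coe_add, NNReal.rpow_add two_ne_zero, two_rpow_smallExponent]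
    simp only [NNReal.coe_one, NNReal.rpow_one]
    push_cast
    ring
  calc cDimStr X ≤ ((1 + smallExponent k : ℝ≥0) : ℝ≥0∞) :=
        cDimStr_le hg fun A _ => mem_strongSuccessSet_of_tendsto
          (tendsto_prodGale_take (n := 0) (fun _ => by positivity) k.succ_pos
            fun _ _ => Nat.lt_succ_self (k + 1))
    _ ≤ 1 + t := by
        push_cast
        gcongr

/-- The sequences along which every constructive gale of exponent less than one is infinitely
often less than one. -/
def gapGeneric : Set CantorSpace :=
  ⋂ d ∈ {d : List Bool → ℝ≥0 | IsLowerSemicomputable d ∧ ∃ s < 1, IsGale s d},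
    {A | ∃ᶠ n in atTop, d (A.take n) < 1}

theorem countable_setOf_gale_lt_one :
    {d : List Bool → ℝ≥0 | IsLowerSemicomputable d ∧ ∃ s < 1, IsGale s d}.Countable :=
  countable_setOf_isLowerSemicomputable.mono fun _ hd => hd.1

theorem isGδ_gapGeneric : IsGδ gapGeneric :=
  IsGδ.biInter countable_setOf_gale_lt_one fun d _ => isGδ_setOf_frequently_take fun w => d w < 1

theorem dense_gapGeneric : Dense gapGeneric := by
  refine dense_biInter_of_Gδ (fun d _ => isGδ_setOf_frequently_take fun w => d w < 1)
    countable_setOf_gale_lt_one ?_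
  rintro d ⟨-, s, hs, hd⟩
  exact dense_setOf_frequently_take (P := fun w => d w < 1) (hd.exists_lt_one hs)

theorem gapGeneric_subset_DIMstr_one : gapGeneric ⊆ DIMstr 1 := by
  intro A hA
  refine le_antisymm (cDimStr_le_one _) (le_sInf ?_)
  rintro _ ⟨s, rfl, d, hd, hs⟩
  by_contra! hs1
  have hfr : ∃ᶠ n in atTop, d (A.take n) < 1 :=
    Set.mem_iInter₂.1 hA d ⟨hd.2, s, by exact_mod_cast hs1, hd.1⟩
  have hlim : liminf (fun n => (d (A.take n) : ℝ≥0∞)) atTop ≤ 1 :=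
    liminf_le_of_frequently_le (hfr.mono fun n hn => by exact_mod_cast hn.le)
  rw [show liminf (fun n => (d (A.take n) : ℝ≥0∞)) atTop = ∞ from hs rfl] at hlim
  exact absurd hlim (by simp)

theorem mainTheorem7 : DIM 0 ∉ BoldSigma 2 ∧ DIMstr 1 ∉ BoldSigma 2 :=
  ⟨not_mem_boldSigma_two isGδ_zeroGeneric dense_zeroGeneric zeroGeneric_subset_DIM_zero
      dense_compl_DIM_zero,
    not_mem_boldSigma_two isGδ_gapGeneric dense_gapGeneric gapGeneric_subset_DIMstr_one
      dense_compl_DIMstr_one⟩
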